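/- All graphs are finite, simple and undirected. For a vertex $v$ of a graph $G$, let $w_G^k(v)$ be the number of walks of length $k$ starting at $v$ and $r_G^k(v)$ the number of closed walks of length $k$ starting and ending at $v$; put $W_G(v)=(w_G^1(v),w_G^2(v),\ldots)$ and $R_G(v)=(r_G^1(v),r_G^2(v),\ldots)$. A vertex $v$ of a connected $n$-vertex graph $G$ is *ambivalent* if there are a connected $n$-vertex graph $H\not\cong G$ and a vertex $u$ of $H$ with $W_G(v)=W_H(u)$ and $R_G(v)=R_H(u)$. Two graphs $G$ and $H$ are *walk-equivalent* if there is a bijection $\alpha:V(G)\to V(H)$ with $W_G(v)=W_H(\alpha(v))$ for all $v\in V(G)$, and $G$ is *walk-identifiable* if it is isomorphic to every graph walk-equivalent to it. **Corollary.** There are walk-identifiable trees with ambivalent vertices. Specifically, let $L$ be the Harary–Palmer tree, that is, the tree on $\{0,1,\ldots,10\}$ with edges $01$, $12$, $23$, $34$, $45$, $46$, $67$, $78$, $89$ and $\{8,10\}$, and let $x=3$ and $y=7$. Let $T=L_x\cdot P_2$ and $S=L_y\cdot P_2$ be the coalescences of $L$, rooted at $x$ and at $y$ respectively, with the single-edge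 graph $P_2$ rooted at one of its ends (that is, $L$ with one new pendant vertex attached to $x$, respectively to $y$). Then $T$ and $S$ are walk-identifiable trees with $12$ vertices, $x$ is an ambivalent vertex of $T$, and $y$ is an ambivalent vertex of $S$. -/

import Mathlib

universe u

/-- `w_G^k(v)`: the number of walks of length `k` in `G` starting at `v`. -/
noncomputable def walkCount {V : Type u} (G : SimpleGraph V) (k : ℕ) (v : V) : ℕ :=
  Nat.card (Σ t : V, {p : G.Walk v t // p.length = k})

/-- `r_G^k(v)`: the number of closed walks of length `k` in `G` starting and ending at `v`. -/
noncomputable def closedWalkCount {V : Type u} (G : SimpleGraph V) (k : ℕ) (v : V) : ℕ :=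
  Nat.card {p : G.Walk v v // p.length = k}

/-- `W_G(v) = (w_G^1(v), w_G^2(v), …)`. -/
noncomputable def walkInvariant {V : Type u} (G : SimpleGraph V) (v : V) : ℕ → ℕ :=
  fun i => walkCount G (i + 1) v

/-- `R_G(v) = (r_G^1(v), r_G^2(v), …)`. -/
noncomputable def closedWalkInvariant {V : Type u} (G : SimpleGraph V) (v : V) : ℕ → ℕ :=
  fun i => closedWalkCount G (i + 1) v

/-- A vertex `v` of a (finite, connected) graph `G` is ambivalent if some connected graph `H` with
the same number of vertices, not isomorphic to `G`, has a vertex `t` with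
`W_G(v) = W_H(t)` and `R_G(v) = R_H(t)`. -/
def IsAmbivalent {V : Type u} [Finite V] (G : SimpleGraph V) (v : V) : Prop :=
  ∃ (V' : Type u) (_ : Finite V') (H : SimpleGraph V') (t : V'),
    H.Connected ∧ Nat.card V' = Nat.card V ∧ ¬ Nonempty (G ≃g H) ∧
      walkInvariant G v = walkInvariant H t ∧
      closedWalkInvariant G v = closedWalkInvariant H t

/-- Two graphs are walk-equivalent if some bijection of their vertex sets matches every vertex
with a vertex having the same walk counts. -/
def WalkEquivalentGraphs {V V' : Type u} (G : SimpleGraph V) (H : SimpleGraph V') : Prop :=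
  ∃ α : V ≃ V', ∀ v : V, walkInvariant G v = walkInvariant H (α v)

/-- A finite graph `G` is walk-identifiable if it is isomorphic to every finite graph (connected
or not) that is walk-equivalent to it. -/
def IsWalkIdentifiable {V : Type u} [Finite V] (G : SimpleGraph V) : Prop :=
  ∀ (V' : Type u) [Finite V'] (H : SimpleGraph V'),
    WalkEquivalentGraphs G H → Nonempty (G ≃g H)

/-- The adjacency relation of the coalescence: the root `z` of `H` is identified with `x`. -/
def coalescenceAdj {V W : Type u} (G : SimpleGraph V) (x : V) (H : SimpleGraph W) (z : W) :
    V ⊕ {w : W // w ≠ z} → V ⊕ {w : W // w ≠ z} → Prop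
  | Sum.inl a, Sum.inl b => G.Adj a b
  | Sum.inl a, Sum.inr w => a = x ∧ H.Adj z w
  | Sum.inr w, Sum.inl a => a = x ∧ H.Adj w z
  | Sum.inr w, Sum.inr w' => H.Adj w w'

/-- The coalescence `G_x · H_z`: the disjoint union of `G` and `H` with `x` and `z` identified.
The coalesced vertex is `Sum.inl x`. -/
def coalescence {V W : Type u} (G : SimpleGraph V) (x : V) (H : SimpleGraph W) (z : W) :
    SimpleGraph (V ⊕ {w : W // w ≠ z}) where
  Adj := coalescenceAdj G x H z
  symm := ⟨by
    rintro (a | w) (b | w') h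
    · exact G.adj_symm h
    · exact ⟨h.1, H.adj_symm h.2⟩
    · exact ⟨h.1, H.adj_symm h.2⟩
    · exact H.adj_symm h⟩
  loopless := ⟨by
    rintro (a | w) h
    · exact G.irrefl h
    · exact H.irrefl h⟩

/-- The Harary–Palmer tree `L` on 11 vertices: the path `0, 1, 2, 3, 4, 6, 7, 8, 10` with a
pendant vertex `5` attached to `4` and a pendant vertex `9` attached to `8`. -/
def hararyPalmerTree : SimpleGraph (Fin 11) :=
  SimpleGraph.fromEdgeSet {s(0, 1), s(1, 2), s(2, 3), s(3, 4), s(4, 5), s(4, 6), s(6, 7),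
    s(7, 8), s(8, 9), s(8, 10)}

/-- The vertex `x` of the Harary–Palmer tree. -/
def hararyPalmerX : Fin 11 := 3

/-- The vertex `y` of the Harary–Palmer tree, pseudosimilar to `x`. -/
def hararyPalmerY : Fin 11 := 7

/-- The tree `L_v · P₂`: a new pendant vertex is attached to the vertex `v` of `L`. -/
def hararyPalmerCoalescence (v : Fin 11) : SimpleGraph (Fin 11 ⊕ {w : Fin 2 // w ≠ 0}) :=
  coalescence hararyPalmerTree v (SimpleGraph.pathGraph 2) 0

/-! The trees `T` and `S` witness ambivalence for each other. An integer matrix `M` with `A_T * M =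
M * A_S` also intertwines all powers. Since `M` has constant row sums `7`, and row `x` and column
`y` of `M` are `7` times basis vectors, walks and closed walks at `x` in `T` and at `y` in `S` are
equinumerous. One walk count shows the trees are not isomorphic.

For identifiability, the walks of length `k + 1` from `v` are counted by summing the length-`k`
counts over the neighbours of `v`. In a walk-equivalent graph, the neighbourhood of `v` therefore
solves a system of subset-sum equations fixed by the counts alone. For `T` and `S` a finite search
finds only the original neighbourhood.

Both trees are transported to `Fin 12`, where these checks are decidable. -/

theorem nat_card_walk_eq_adjMatrix_pow {V : Type u} [Fintype V] [DecidableEq V]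
    (G : SimpleGraph V) [DecidableRel G.Adj] (k : ℕ) (v t : V) :
    (Nat.card {p : G.Walk v t // p.length = k} : ℤ) = (G.adjMatrix ℤ ^ k) v t := by
  rw [SimpleGraph.adjMatrix_pow_apply_eq_card_walk, ← Nat.card_eq_fintype_card]
  rfl

theorem walkCount_eq_adjMatrix_pow {V : Type u} [Fintype V] [DecidableEq V]
    (G : SimpleGraph V) [DecidableRel G.Adj] (k : ℕ) (v : V) :
    (walkCount G k v : ℤ) = ((G.adjMatrix ℤ ^ k).mulVec 1) v := by
  have (t : V) : Finite {p : G.Walk v t // p.length = k} :=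
    inferInstanceAs (Finite {p : G.Walk v t | p.length = k})
  rw [walkCount, Nat.card_sigma, Nat.cast_sum]
  simp only [nat_card_walk_eq_adjMatrix_pow]
  simp [Matrix.mulVec, dotProduct]

theorem walkCount_zero {V : Type u} [Finite V] (G : SimpleGraph V) (v : V) :
    walkCount G 0 v = 1 := by
  classical
  have := Fintype.ofFinite V
  zify
  simp [walkCount_eq_adjMatrix_pow]

theorem walkCount_succ {V : Type u} [Fintype V] (G : SimpleGraph V) [DecidableRel G.Adj]
    (k : ℕ) (v : V) :
    walkCount G (k + 1) v = ∑ t, if G.Adj v t then walkCount G k t else 0 := by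
  classical
  zify
  simp only [walkCount_eq_adjMatrix_pow, pow_succ', ← Matrix.mulVec_mulVec]
  simp [Matrix.mulVec, dotProduct, SimpleGraph.adjMatrix_apply, ite_mul]

/-! ### Invariance under isomorphism -/

namespace SimpleGraph.Iso

variable {V W : Type u} [Finite V] [Finite W] {G : SimpleGraph V} {H : SimpleGraph W}

theorem card_walk_eq (e : G ≃g H) (k : ℕ) (v t : V) :
    Nat.card {p : H.Walk (e v) (e t) // p.length = k} =
      Nat.card {p : G.Walk v t // p.length = k} := by
  classical
  have := Fintype.ofFinite V
  have := Fintype.ofFinite W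
  apply Nat.cast_injective (R := ℤ)
  simp only [nat_card_walk_eq_adjMatrix_pow]
  induction k generalizing v t with
  | zero => simp [Matrix.one_apply]
  | succ k ih =>
    simp only [pow_succ', SimpleGraph.adjMatrix_mul_apply]
    refine (Finset.sum_bij' (fun a _ => e a) (fun a _ => e.symm a) ?_ ?_ ?_ ?_ ?_).symm
    · simp [e.map_adj_iff]
    · intro a ha
      simpa [← e.map_adj_iff] using ha
    · simp
    · simp
    · intro a _
      rw [ih]

theorem walkInvariant_eq (e : G ≃g H) (v : V) : walkInvariant H (e v) = walkInvariant G v := by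
  have := Fintype.ofFinite V
  have := Fintype.ofFinite W
  funext k
  have (t : V) : Finite {p : G.Walk v t // p.length = k + 1} := by
    classical exact inferInstanceAs (Finite {p : G.Walk v t | p.length = k + 1})
  have (t : W) : Finite {p : H.Walk (e v) t // p.length = k + 1} := by
    classical exact inferInstanceAs (Finite {p : H.Walk (e v) t | p.length = k + 1})
  rw [walkInvariant, walkInvariant, walkCount, walkCount, Nat.card_sigma, Nat.card_sigma]
  exact (Fintype.sum_equiv e.toEquiv _ _ fun t => (e.card_walk_eq _ _ _).symm).symm

theorem closedWalkInvariant_eq (e : G ≃g H) (v : V) :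
    closedWalkInvariant H (e v) = closedWalkInvariant G v :=
  funext fun _ => e.card_walk_eq _ _ _

theorem isWalkIdentifiable (e : G ≃g H) (hG : IsWalkIdentifiable G) : IsWalkIdentifiable H := by
  rintro V' _ K ⟨α, hα⟩
  obtain ⟨f⟩ := hG V' K ⟨e.toEquiv.trans α, fun v => by
    rw [← e.walkInvariant_eq]; exact hα (e v)⟩
  exact ⟨e.symm.trans f⟩

theorem isAmbivalent (e : G ≃g H) {v : V} (hv : IsAmbivalent G v) : IsAmbivalent H (e v) := by
  obtain ⟨V', hV', K, t, hK, hcard, hiso, hW, hR⟩ := hv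
  exact ⟨V', hV', K, t, hK, hcard.trans (Nat.card_congr e.toEquiv),
    fun ⟨f⟩ => hiso ⟨e.trans f⟩, by rw [e.walkInvariant_eq, hW],
    by rw [e.closedWalkInvariant_eq, hR]⟩

end SimpleGraph.Iso

/-! ### Equal walk counts from intertwining matrices -/

section Intertwining

variable {V W : Type u} [Fintype V] [Fintype W] [DecidableEq V] [DecidableEq W]

theorem Matrix.pow_mul_eq_mul_pow {A : Matrix V V ℤ} {B : Matrix W W ℤ} {M : Matrix V W ℤ}
    (h : A * M = M * B) (k : ℕ) : A ^ k * M = M * B ^ k := by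
  induction k with
  | zero => simp
  | succ k ih => rw [pow_succ, Matrix.mul_assoc, h, ← Matrix.mul_assoc, ih, pow_succ,
      Matrix.mul_assoc]

variable {G : SimpleGraph V} {H : SimpleGraph W} [DecidableRel G.Adj] [DecidableRel H.Adj]
  {M : Matrix V W ℤ} {c : ℤ} {v : V} {t : W}

/-- Evaluate `A ^ k * M * 1 = M * B ^ k * 1` at `v`: the left side is `c` times the count at `v`,
the right side `c` times that at `t`. The scale `c` allows `M` to be integral. -/
theorem walkInvariant_eq_of_intertwining (hM : G.adjMatrix ℤ * M = M * H.adjMatrix ℤ)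
    (hc : c ≠ 0) (hone : M.mulVec 1 = fun _ => c) (hrow : M v = Pi.single t c) :
    walkInvariant G v = walkInvariant H t := by
  funext k
  have h : ((G.adjMatrix ℤ ^ (k + 1) * M).mulVec 1) v =
      ((M * H.adjMatrix ℤ ^ (k + 1)).mulVec 1) v := by
    rw [Matrix.pow_mul_eq_mul_pow hM]
  have hone' : M.mulVec 1 = c • (1 : V → ℤ) := by rw [hone]; ext; simp
  rw [← Matrix.mulVec_mulVec, ← Matrix.mulVec_mulVec, hone', Matrix.mulVec_smul, Pi.smul_apply,
    ← walkCount_eq_adjMatrix_pow, Matrix.mulVec.eq_def M] at h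
  simp only [hrow, single_dotProduct, ← walkCount_eq_adjMatrix_pow, smul_eq_mul] at h
  exact_mod_cast mul_left_cancel₀ hc h

/-- Compare the `(v, t)` entries of `A ^ k * M` and `M * B ^ k`: column `t` of `M` isolates `(A ^ k)
v v`, row `v` isolates `(B ^ k) t t`. -/
theorem closedWalkInvariant_eq_of_intertwining (hM : G.adjMatrix ℤ * M = M * H.adjMatrix ℤ)
    (hc : c ≠ 0) (hrow : M v = Pi.single t c) (hcol : M.col t = Pi.single v c) :
    closedWalkInvariant G v = closedWalkInvariant H t := by
  funext k
  have h : (G.adjMatrix ℤ ^ (k + 1) * M) v t = (M * H.adjMatrix ℤ ^ (k + 1)) v t := by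
    rw [Matrix.pow_mul_eq_mul_pow hM]
  have hcol' : (fun j => M j t) = Pi.single v c := hcol
  rw [Matrix.mul_apply', Matrix.mul_apply', hcol', hrow, single_dotProduct, dotProduct_single,
    mul_comm, ← nat_card_walk_eq_adjMatrix_pow, ← nat_card_walk_eq_adjMatrix_pow] at h
  exact_mod_cast mul_left_cancel₀ hc h

end Intertwining

/-! ### Walk-identifiability from determined neighbourhoods -/

/-- If the first walk counts of `G`, listed in `w`, determine each neighbourhood in `G` through the
linear recurrence that walk counts satisfy, then `G` is walk-identifiable. -/
theorem isWalkIdentifiable_of_neighborhoods_determined {V : Type u} [Fintype V]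
    (G : SimpleGraph V) [DecidableRel G.Adj] {n : ℕ} (w : Fin (n + 1) → V → ℕ)
    (hzero : ∀ v, w 0 v = 1)
    (hsucc : ∀ (k : Fin n) (v : V), (∑ t, if G.Adj v t then w k.castSucc t else 0) = w k.succ v)
    (hdet : ∀ (v : V) (a : V → ℕ), (∀ t, a t ≤ 1) → a v = 0 →
      (∀ k : Fin n, ∑ t, a t * w k.castSucc t = w k.succ v) →
      ∀ t, a t = if G.Adj v t then 1 else 0) :
    IsWalkIdentifiable G := by
  classical
  have hw (k : Fin (n + 1)) (v : V) : walkCount G k v = w k v := by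
    induction k using Fin.induction generalizing v with
    | zero => rw [Fin.val_zero, walkCount_zero, hzero]
    | succ k ih =>
      rw [Fin.val_succ, walkCount_succ, ← hsucc]
      exact Finset.sum_congr rfl fun t _ => by rw [← ih t, Fin.val_castSucc]
  rintro V' _ H ⟨α, hα⟩
  have := Fintype.ofFinite V'
  have hH (k : Fin (n + 1)) (v : V) : walkCount H k (α v) = w k v := by
    rw [← hw]
    obtain ⟨_ | k, hk⟩ := k
    -- Length `0` is not recorded in the invariant, but its count is always `1`.
    · rw [walkCount_zero, walkCount_zero]
    · exact (congrFun (hα v) k).symm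
  refine ⟨⟨α, fun {v t} => ?_⟩⟩
  -- The neighbourhood of `α v` in `H`, pulled back along `α`, solves the system for `v`; hence `α`
  -- itself is an isomorphism.
  have key := hdet v (fun t => if H.Adj (α v) (α t) then 1 else 0)
    (fun t => by split_ifs <;> simp) (by simp) (fun k => by
      rw [← hH, Fin.val_succ, walkCount_succ, ← Equiv.sum_comp α]
      exact Finset.sum_congr rfl fun t _ => by rw [← hH]; simp [ite_mul]) t
  by_cases h1 : H.Adj (α v) (α t) <;> by_cases h2 : G.Adj v t <;> simp_all

/-! ### Computable models of the two trees -/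

/-- The graph joining every vertex to its parent under `p` (roots are fixed by `p`). -/
def parentGraph {V : Type*} (p : V → V) : SimpleGraph V where
  Adj a b := a ≠ b ∧ (p a = b ∨ p b = a)
  symm := ⟨fun _ _ h => ⟨h.1.symm, h.2.symm⟩⟩
  loopless := ⟨fun _ h => h.1 rfl⟩

instance {V : Type*} [DecidableEq V] (p : V → V) : DecidableRel (parentGraph p).Adj :=
  fun a b => inferInstanceAs (Decidable (a ≠ b ∧ (p a = b ∨ p b = a)))

theorem parentGraph_connected {n : ℕ} (p : Fin (n + 1) → Fin (n + 1))
    (hp : ∀ v, v ≠ 0 → p v < v) : (parentGraph p).Connected := by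
  have h (v : Fin (n + 1)) : (parentGraph p).Reachable v 0 := by
    induction v using WellFoundedLT.induction with
    | ind v ih =>
      by_cases hv : v = 0
      · rw [hv]
      · have hadj : (parentGraph p).Adj v (p v) := ⟨(hp v hv).ne', Or.inl rfl⟩
        exact hadj.reachable.trans (ih _ (hp v hv))
  exact ⟨fun a b => (h a).trans (h b).symm⟩

/-- The parent function, with root `0`, of the Harary–Palmer tree with a new pendant vertex `11`
attached to `r`. -/
def pendantParent (r : Fin 12) : Fin 12 → Fin 12 := ![0, 0, 1, 2, 3, 4, 4, 6, 7, 8, 8, r]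

/-- The Harary–Palmer tree with a new pendant vertex `11` attached to `r`. -/
abbrev pendantTree (r : Fin 12) : SimpleGraph (Fin 12) := parentGraph (pendantParent r)

theorem pendantTree_isTree {r : Fin 12} (hr : r = 3 ∨ r = 7) : (pendantTree r).IsTree := by
  rw [SimpleGraph.isTree_iff_connected_and_card]
  refine ⟨parentGraph_connected _ ?_, ?_⟩
  · rcases hr with rfl | rfl <;> decide
  · rw [Nat.card_eq_fintype_card, ← SimpleGraph.edgeFinset_card]
    rcases hr with rfl | rfl <;> (simp; decide +kernel)

/-- The vertex labelling of `L_v · P₂` by `Fin 12`. -/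
def coalescenceEquiv : Fin 11 ⊕ {w : Fin 2 // w ≠ 0} ≃ Fin 12 where
  toFun := Sum.elim Fin.castSucc fun _ => 11
  invFun i := if h : i.val < 11 then Sum.inl ⟨i, h⟩ else Sum.inr ⟨1, by decide⟩
  left_inv := by decide
  right_inv := by decide

/-- The parent `0` of the vertex `11` is a dummy: `11` is not in the range of `Fin.castSucc`. -/
theorem hararyPalmerTree_adj (a b : Fin 11) : hararyPalmerTree.Adj a b ↔
    (pendantTree 0).Adj a.castSucc b.castSucc := by
  simp only [hararyPalmerTree, SimpleGraph.fromEdgeSet_adj, Set.mem_insert_iff,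
    Set.mem_singleton_iff, Sym2.eq_iff]
  decide +kernel +revert

theorem coalescence_adj (r : Fin 11) (a b : Fin 11 ⊕ {w : Fin 2 // w ≠ 0}) :
    (pendantTree r.castSucc).Adj (coalescenceEquiv a) (coalescenceEquiv b) ↔
      (hararyPalmerCoalescence r).Adj a b := by
  have hinr (w : {w : Fin 2 // w ≠ 0}) : w = ⟨1, by decide⟩ := by decide +revert
  rcases a with a | w <;> rcases b with b | w'
  · change _ ↔ hararyPalmerTree.Adj a b
    rw [hararyPalmerTree_adj]
    decide +kernel +revert
  · change _ ↔ a = r ∧ (SimpleGraph.pathGraph 2).Adj 0 w'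
    rw [hinr w', SimpleGraph.pathGraph_adj]
    decide +kernel +revert
  · change _ ↔ b = r ∧ (SimpleGraph.pathGraph 2).Adj w 0
    rw [hinr w, SimpleGraph.pathGraph_adj]
    decide +kernel +revert
  · change _ ↔ (SimpleGraph.pathGraph 2).Adj w w'
    rw [hinr w, hinr w']
    simp

/-- `L_r · P₂` as a tree on `Fin 12`. -/
def coalescenceIso (r : Fin 11) : hararyPalmerCoalescence r ≃g pendantTree r.castSucc where
  toEquiv := coalescenceEquiv
  map_rel_iff' := coalescence_adj r _ _

/-! ### Subset-sum search -/

/-- The `0`-`1` vectors `a` with `∑ i, ws i * a i = s`. -/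
def subsetSumSolutions : List ℕ → ℕ → List (List ℕ)
  | [], s => if s = 0 then [[]] else []
  | w :: ws, s => (subsetSumSolutions ws s).map (0 :: ·) ++
      if w ≤ s then (subsetSumSolutions ws (s - w)).map (1 :: ·) else []

theorem mem_subsetSumSolutions {n : ℕ} (w a : Fin n → ℕ) (ha : ∀ i, a i ≤ 1) :
    List.ofFn a ∈ subsetSumSolutions (List.ofFn w) (∑ i, a i * w i) := by
  induction n with
  | zero => simp [subsetSumSolutions]
  | succ n ih =>
    have h := ih (fun i => w i.succ) (fun i => a i.succ) fun i => ha i.succ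
    rw [List.ofFn_succ, List.ofFn_succ, Fin.sum_univ_succ, subsetSumSolutions, List.mem_append]
    rcases Nat.le_one_iff_eq_zero_or_eq_one.mp (ha 0) with h0 | h0
    · exact Or.inl (by simpa [h0] using h)
    · exact Or.inr (by simpa [h0] using h)

/-- A computable criterion for walk-identifiability: the walk counts up to length `n` of each
vertex, encoded in base `b`, are written in only one way as a sum of encoded walk counts of other
vertices. -/
theorem isWalkIdentifiable_of_subsetSumSolutions {m n : ℕ} (G : SimpleGraph (Fin m))
    [DecidableRel G.Adj] (w : Fin (n + 1) → Fin m → ℕ) (b : ℕ) (hzero : ∀ v, w 0 v = 1)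
    (hsucc : ∀ (k : Fin n) (v : Fin m),
      (∑ t, if G.Adj v t then w k.castSucc t else 0) = w k.succ v)
    (hsol : ∀ v, ∀ l ∈ subsetSumSolutions
        (List.ofFn fun t => ∑ k : Fin n, w k.castSucc t * b ^ k.val)
        (∑ k : Fin n, w k.succ v * b ^ k.val),
      l[v.val]? = some 0 → l = List.ofFn fun t => if G.Adj v t then 1 else 0) :
    IsWalkIdentifiable G := by
  refine isWalkIdentifiable_of_neighborhoods_determined G w hzero hsucc fun v a ha hv h => ?_
  have hmem := mem_subsetSumSolutions (fun t => ∑ k : Fin n, w k.castSucc t * b ^ k.val) a ha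
  -- The separate equations imply the encoded one for every base `b`, so no bound on `b` is needed
  -- for soundness; a large base only avoids spurious solutions.
  have hsum : ∑ t, a t * ∑ k : Fin n, w k.castSucc t * b ^ k.val =
      ∑ k : Fin n, w k.succ v * b ^ k.val := by
    simp only [← h, Finset.mul_sum, Finset.sum_mul, ← mul_assoc]
    exact Finset.sum_comm
  rw [hsum] at hmem
  exact congrFun (List.ofFn_injective (hsol v _ hmem (by simp [hv])))

theorem pendantTree_three_isWalkIdentifiable : IsWalkIdentifiable (pendantTree 3) :=
  isWalkIdentifiable_of_subsetSumSolutions (n := 6) _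
    -- Row `k` lists the walk counts of length `k`. The leaves `5` and `11` agree up to length `4`
    -- and differ at length `5`, which forces `n = 6`. The base exceeds every possible digit sum, so
    -- there are no carries.
    ![![1, 1, 1, 1, 1, 1, 1, 1, 1, 1, 1, 1],
      ![1, 2, 2, 3, 3, 1, 2, 2, 3, 1, 1, 1],
      ![2, 3, 5, 6, 6, 3, 5, 5, 4, 3, 3, 3],
      ![3, 7, 9, 14, 14, 6, 11, 9, 11, 4, 4, 6],
      ![7, 12, 21, 29, 31, 14, 23, 22, 17, 11, 11, 14],
      ![12, 28, 41, 66, 66, 31, 53, 40, 44, 17, 17, 29],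
      ![28, 53, 94, 136, 150, 66, 106, 97, 74, 44, 44, 66]]
    10000 (by decide) (by decide +kernel) (by decide +kernel)

theorem pendantTree_seven_isWalkIdentifiable : IsWalkIdentifiable (pendantTree 7) :=
  isWalkIdentifiable_of_subsetSumSolutions (n := 6) _
    ![![1, 1, 1, 1, 1, 1, 1, 1, 1, 1, 1, 1],
      ![1, 2, 2, 2, 3, 1, 2, 3, 3, 1, 1, 1],
      ![2, 3, 4, 5, 5, 3, 6, 6, 5, 3, 3, 3],
      ![3, 6, 8, 9, 14, 5, 11, 14, 12, 5, 5, 6],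
      ![6, 11, 15, 22, 25, 14, 28, 29, 24, 12, 12, 14],
      ![11, 21, 33, 40, 64, 25, 54, 66, 53, 24, 24, 29],
      ![21, 44, 61, 97, 119, 64, 130, 136, 114, 53, 53, 66]]
    10000 (by decide) (by decide +kernel) (by decide +kernel)

/-! ### Ambivalence of the two roots -/

/-- An integer matrix intertwining the adjacency matrices of `pendantTree 3` and `pendantTree 7`;
one seventh of it fixes the all-ones vector and interchanges the basis vectors `3` and `7`. -/
def pendantIntertwiner : Matrix (Fin 12) (Fin 12) ℤ :=
  !![2, -1, 2, 0, -2, 4, -3, 0, 3, 1, 1, 0;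
    -1, 4, -1, 0, 1, -2, -2, 0, 2, 3, 3, 0;
    2, -1, 2, 0, -2, -3, 4, 0, 3, 1, 1, 0;
    0, 0, 0, 0, 0, 0, 0, 7, 0, 0, 0, 0;
    -2, 1, -2, 0, 2, 3, 3, 0, 4, -1, -1, 0;
    4, -2, -3, 0, 3, 1, 1, 0, -1, 2, 2, 0;
    -3, -2, 4, 0, 3, 1, 1, 0, -1, 2, 2, 0;
    0, 0, 0, 7, 0, 0, 0, 0, 0, 0, 0, 0;
    3, 2, 3, 0, 4, -1, -1, 0, 1, -2, -2, 0;
    1, 3, 1, 0, -1, 2, 2, 0, -2, 0, 1, 0;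
    1, 3, 1, 0, -1, 2, 2, 0, -2, 1, 0, 0;
    0, 0, 0, 0, 0, 0, 0, 0, 0, 0, 0, 7]

/-- The block of the matrix on the first eleven vertices commutes with the adjacency matrix of `L`.
As it exchanges `3` and `7` up to the factor `7`, the diagonal entry `7` at the vertex `11` extends
it to the pendant edges. -/
theorem pendantIntertwiner_intertwines :
    (pendantTree 3).adjMatrix ℤ * pendantIntertwiner =
      pendantIntertwiner * (pendantTree 7).adjMatrix ℤ := by
  decide +kernel

theorem walkInvariant_pendantTree :
    walkInvariant (pendantTree 3) 3 = walkInvariant (pendantTree 7) 7 :=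
  walkInvariant_eq_of_intertwining (c := 7) pendantIntertwiner_intertwines (by decide)
    (by decide +kernel) (by decide +kernel)

theorem closedWalkInvariant_pendantTree :
    closedWalkInvariant (pendantTree 3) 3 = closedWalkInvariant (pendantTree 7) 7 :=
  closedWalkInvariant_eq_of_intertwining (c := 7) pendantIntertwiner_intertwines (by decide)
    (by decide +kernel) (by decide +kernel)

theorem not_nonempty_iso_pendantTree : ¬ Nonempty (pendantTree 3 ≃g pendantTree 7) := by
  rintro ⟨e⟩
  -- Index `2` of the invariant is length `3`. The vertex `1` starts seven such walks in the first
  -- tree; no vertex of the second does.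
  have h : walkCount (pendantTree 7) 3 (e 1) = walkCount (pendantTree 3) 3 1 :=
    congrFun (e.walkInvariant_eq 1) 2
  have h3 : (((pendantTree 3).adjMatrix ℤ ^ 3).mulVec 1) 1 = 7 := by decide +kernel
  have h7 : ∀ v, (((pendantTree 7).adjMatrix ℤ ^ 3).mulVec 1) v ≠ 7 := by decide +kernel
  apply h7 (e 1)
  rw [← walkCount_eq_adjMatrix_pow, h, walkCount_eq_adjMatrix_pow, h3]

theorem pendantTree_three_isAmbivalent : IsAmbivalent (pendantTree 3) 3 :=
  ⟨Fin 12, inferInstance, pendantTree 7, 7, (pendantTree_isTree (.inr rfl)).connected, rfl,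
    not_nonempty_iso_pendantTree, walkInvariant_pendantTree, closedWalkInvariant_pendantTree⟩

theorem pendantTree_seven_isAmbivalent : IsAmbivalent (pendantTree 7) 7 :=
  ⟨Fin 12, inferInstance, pendantTree 3, 3, (pendantTree_isTree (.inl rfl)).connected, rfl,
    fun ⟨e⟩ => not_nonempty_iso_pendantTree ⟨e.symm⟩, walkInvariant_pendantTree.symm,
    closedWalkInvariant_pendantTree.symm⟩

theorem corollary2 :
    (∃ (n : ℕ) (T : SimpleGraph (Fin n)),
      T.IsTree ∧ IsWalkIdentifiable T ∧ ∃ v : Fin n, IsAmbivalent T v) ∧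
    Nat.card (Fin 11 ⊕ {w : Fin 2 // w ≠ 0}) = 12 ∧
    ((hararyPalmerCoalescence hararyPalmerX).IsTree ∧
      IsWalkIdentifiable (hararyPalmerCoalescence hararyPalmerX) ∧
      IsAmbivalent (hararyPalmerCoalescence hararyPalmerX) (Sum.inl hararyPalmerX)) ∧
    ((hararyPalmerCoalescence hararyPalmerY).IsTree ∧
      IsWalkIdentifiable (hararyPalmerCoalescence hararyPalmerY) ∧
      IsAmbivalent (hararyPalmerCoalescence hararyPalmerY) (Sum.inl hararyPalmerY)) := by
  have hx : (coalescenceIso hararyPalmerX).symm 3 = Sum.inl hararyPalmerX := by decide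
  have hy : (coalescenceIso hararyPalmerY).symm 7 = Sum.inl hararyPalmerY := by decide
  refine ⟨⟨12, pendantTree 3, pendantTree_isTree (.inl rfl), pendantTree_three_isWalkIdentifiable,
    3, pendantTree_three_isAmbivalent⟩, ?_, ⟨?_, ?_, ?_⟩, ?_, ?_, ?_⟩
  · rw [Nat.card_congr coalescenceEquiv, Nat.card_fin]
  · exact (coalescenceIso hararyPalmerX).isTree_iff.mpr (pendantTree_isTree (.inl rfl))
  · exact (coalescenceIso hararyPalmerX).symm.isWalkIdentifiable
      pendantTree_three_isWalkIdentifiable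
  · exact hx ▸ (coalescenceIso hararyPalmerX).symm.isAmbivalent pendantTree_three_isAmbivalent
  · exact (coalescenceIso hararyPalmerY).isTree_iff.mpr (pendantTree_isTree (.inr rfl))
  · exact (coalescenceIso hararyPalmerY).symm.isWalkIdentifiable
      pendantTree_seven_isWalkIdentifiable
  · exact hy ▸ (coalescenceIso hararyPalmerY).symm.isAmbivalent pendantTree_seven_isAmbivalent
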